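/- Let $G$ be a finite abelian group, written multiplicatively. For a subset $S\subseteq G$ write $S$ also for the element $\sum_{g\in S} g$ of the integral group ring $\mathbb{Z}G$, and put $S^{(-1)}=\sum_{g\in S} g^{-1}$. A subset $D\subseteq G$ with $|D|=k\ge 1$ is a $(v,k,\lambda)$-difference set in $G$ if $|G|=v$ and $DD^{(-1)}=\lambda G+(k-\lambda)1$ in $\mathbb{Z}G$; it is normalized if $\prod_{d\in D}d=1$. Theorem 6.1. Let $s$ be an odd positive integer, and let $D$ be a normalized difference set in a finite abelian group $G$ with the parameters of $PG(3,2^s)$, that is, $$(v,k,\lambda)=\left(\frac{2^{4s}-1}{2^s-1},\ \frac{2^{3s}-1}{2^s-1},\ \frac{2^{2s}-1}{2^s-1}\right).$$ Then $G$ has a subgroup $M$ of order $15$ such that $D\cap M$ is a $(15,7,3)$-difference set in $M$. Moreover, $M$ can be chosen so that, for some $h\in M$ of order $3$ and some $k\in M$ of order $5$, $$D\cap M=\{1,\,h,\,h^2,\,hk,\,h^2k^2,\,hk^4,\,h^2k^3\}.$$ -/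

import Mathlib

/-- The element `∑_{g ∈ S} g` of the integral group ring `ℤG` attached to a subset `S` of a
finite group `G`. -/
noncomputable def groupRingElt {G : Type*} [Group G] [Finite G] (S : Set G) :
    MonoidAlgebra ℤ G :=
  ∑ᶠ g ∈ S, MonoidAlgebra.single g 1

/-- For `a = ∑ a_g g` in `ℤG`, the element `a^{(-1)} = ∑ a_g g⁻¹`. -/
noncomputable def groupRingInv {G : Type*} [Group G] [Finite G] (a : MonoidAlgebra ℤ G) :
    MonoidAlgebra ℤ G :=
  MonoidAlgebra.mapDomain (fun g : G => g⁻¹) a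

/-- `D` is a `(v, k, l)`-difference set in the finite group `G`: `|G| = v`, `D` is a nonempty
`k`-subset of `G`, and `D D^{(-1)} = l G + n 1` in `ℤG`, where `n = k - l` is the order of `D`. -/
def IsDifferenceSet {G : Type*} [Group G] [Finite G] (D : Set G) (v k l : ℕ) : Prop :=
  Nat.card G = v ∧ D.ncard = k ∧ 1 ≤ k ∧
    groupRingElt D * groupRingInv (groupRingElt D) =
      (l : ℤ) • groupRingElt (Set.univ : Set G) + ((k : ℤ) - (l : ℤ)) • (1 : MonoidAlgebra ℤ G)

/-- A subset `D` of a finite abelian group is normalized if the product of its elements is `1`. -/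
def IsNormalized {G : Type*} [CommGroup G] [Finite G] (D : Set G) : Prop :=
  ∏ᶠ d ∈ D, d = 1

/-! Put `q = 2 ^ s`. Then `|G| = (q + 1)(q ^ 2 + 1)` with coprime odd factors, so G is the product
of subgroups A and B of orders `q + 1` and `q ^ 2 + 1`. The aim is to read off D modulo each factor
and then inspect a few powers of one element.

Squaring group elements is a Frobenius lift at 2 on ℤG, of finite order since `|G|` is odd. Hence
twisting one factor of a product by it preserves divisibility by powers of 2
(`two_pow_dvd_frobeniusLift_mul`). Applied to D D^{(-1)}, this makes 2 a multiplier, and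
normalization removes the translation: D is closed under squaring.

Modulo A or B, -1 is a power of 2, so the image of D is fixed by inversion and its order equation
becomes that of a square. ℤG is reduced modulo 2, so the root can be divided by q; what remains is a
unit with z z^{(-1)} = 1 fixed by squaring, hence trivial. The two images say that D contains A,
meets every other coset of A once, and meets B only in 1.

Oddness of s gives 5 ∣ `q ^ 2 + 1`. For k in B of order 5, the unique d = hk in D ∩ Ak satisfies d ^
16 = d, which forces h to have order 3. The coset counts then decide which powers of hk lie in D. -/

open MonoidAlgebra

/-! ### Divisibility by powers of 2 in rings with a Frobenius lift. -/

section FrobeniusLift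

variable {R : Type*} [CommRing R] {φ : R →+* R} {f : ℕ}

theorem two_dvd_iterate_frobeniusLift_sub_pow (hφ : ∀ x, (2 : R) ∣ φ x - x ^ 2) (n : ℕ) (x : R) :
    (2 : R) ∣ φ^[n] x - x ^ 2 ^ n := by
  induction n with
  | zero => simp
  | succ n ih =>
    rw [Function.iterate_succ_apply']
    have h := (map_dvd φ ih)
    rw [map_ofNat, map_sub, map_pow] at h
    have h' : (2 : R) ∣ φ x ^ 2 ^ n - (x ^ 2) ^ 2 ^ n := (hφ x).trans (sub_dvd_pow_sub_pow _ _ _)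
    have e : φ (φ^[n] x) - x ^ 2 ^ (n + 1) =
        (φ (φ^[n] x) - φ x ^ 2 ^ n) + (φ x ^ 2 ^ n - (x ^ 2) ^ 2 ^ n) := by
      rw [← pow_mul, pow_succ']; ring
    rw [e]
    exact dvd_add h h'

theorem two_dvd_pow_two_pow_sub_self (hφ : ∀ x, (2 : R) ∣ φ x - x ^ 2) (hf : φ^[f] = id) (x : R) :
    (2 : R) ∣ x ^ 2 ^ f - x := by
  have h := two_dvd_iterate_frobeniusLift_sub_pow hφ f x
  rw [hf, id, dvd_sub_comm] at h
  exact h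

/-- In a ring with a Frobenius lift of finite order, applying the lift to a factor does not change
the divisibility of a product by powers of two. -/
theorem two_pow_dvd_frobeniusLift_mul (hφ : ∀ x, (2 : R) ∣ φ x - x ^ 2) (hf : φ^[f] = id)
    (hf0 : 1 ≤ f) (h2 : ∀ x y : R, 2 * x = 2 * y → x = y) (m : ℕ) (x y : R)
    (h : (2 : R) ^ m ∣ x * y) : (2 : R) ^ m ∣ φ x * y := by
  induction m generalizing x with
  | zero => simp
  | succ m ih =>
    -- With a = 2 ^ f - 2, x ^ (a + 2) ≡ x modulo 2, so x ^ (a + 1) is idempotent modulo 2.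
    obtain ⟨a, ha⟩ : ∃ a, 2 ^ f = a + 1 + 1 := by
      have : 2 ^ 1 ≤ 2 ^ f := Nat.pow_le_pow_right (by norm_num) hf0
      exact ⟨2 ^ f - 2, by omega⟩
    have hx : (2 : R) ∣ x ^ (a + 1 + 1) - x := ha ▸ two_dvd_pow_two_pow_sub_self hφ hf x
    -- a lift of the idempotent generating the ideal of `x` modulo `2`
    set e : R := (x ^ (a + 1)) ^ 2 ^ m with he
    obtain ⟨b, hb⟩ : ∃ b, e = x * b := by
      refine dvd_trans (dvd_pow_self x (Nat.succ_ne_zero a)) (dvd_pow_self _ (by positivity))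
    -- φ fixes the idempotent x ^ (a + 1) modulo 2; taking 2 ^ m-th powers lifts this congruence to
    -- modulus 2 ^ (m + 1).
    have hφe : (2 : R) ^ (m + 1) ∣ φ e - e := by
      have h1 : ((2 : ℕ) : R) ∣ φ (x ^ (a + 1)) - x ^ (a + 1) := by
        have h3 : (2 : R) ∣ φ x ^ (a + 1) - (x ^ 2) ^ (a + 1) :=
          (hφ x).trans (sub_dvd_pow_sub_pow _ _ _)
        have h4 : φ (x ^ (a + 1)) - x ^ (a + 1) =
            (φ x ^ (a + 1) - (x ^ 2) ^ (a + 1)) + (x ^ (a + 1 + 1) - x) * x ^ a := by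
          rw [map_pow]; ring
        rw [h4, Nat.cast_ofNat]
        exact dvd_add h3 (hx.mul_right _)
      have h5 := dvd_sub_pow_of_dvd_sub h1 m
      rwa [Nat.cast_ofNat, ← map_pow] at h5
    have hex : (2 : R) ∣ x - e * x := by
      have key : ∀ n : ℕ, (2 : R) ∣ x - (x ^ (a + 1)) ^ n * x := by
        intro n
        induction n with
        | zero => simp
        | succ n ihn =>
          have : x - (x ^ (a + 1)) ^ (n + 1) * x =
            (x - (x ^ (a + 1)) ^ n * x) - (x ^ (a + 1)) ^ n * (x ^ (a + 1 + 1) - x) := by ring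
          rw [this]
          exact dvd_sub ihn (hx.mul_left _)
      exact key _
    -- Split x = e x + 2 x'. The induction hypothesis handles x', while φ e ≡ e = x b brings back
    -- the factor x y in the other term.
    obtain ⟨x', hx'⟩ := hex
    have h6 : (2 : R) ^ m ∣ x' * y := by
      have h7 : (2 : R) ^ (m + 1) ∣ 2 * (x' * y) := by
        have : 2 * (x' * y) = x * y * (1 - e) := by rw [← mul_assoc, ← hx']; ring
        rw [this]
        exact h.mul_right _
      obtain ⟨c, hc⟩ := h7
      exact ⟨c, h2 _ _ (by rw [hc]; ring)⟩
    obtain ⟨c, hc⟩ := ih x' h6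
    obtain ⟨d, hd⟩ := hφe
    obtain ⟨w, hw⟩ := h
    have h8 : φ x - φ e * φ x = 2 * φ x' := by
      rw [← map_mul, ← map_sub, hx', map_mul, map_ofNat]
    refine ⟨c + d * φ x * y + b * φ x * w, ?_⟩
    linear_combination y * h8 + 2 * hc + φ x * y * hd + φ x * y * hb + b * φ x * hw

/-- A ring with a Frobenius lift of finite order is reduced modulo two. -/
theorem two_pow_dvd_of_two_pow_dvd_mul_self (hφ : ∀ x, (2 : R) ∣ φ x - x ^ 2) (hf : φ^[f] = id)
    (hf0 : 1 ≤ f) (h2 : ∀ x y : R, 2 * x = 2 * y → x = y) (m : ℕ) (x : R)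
    (h : (2 : R) ^ (2 * m) ∣ x * x) : (2 : R) ^ m ∣ x := by
  induction m generalizing x with
  | zero => simp
  | succ m ih =>
    -- x ≡ x ^ 2 ^ f modulo 2, and the right side is a multiple of x * x.
    have h1 : (2 : R) ∣ x := by
      have h3 : (2 : R) ∣ x ^ 2 ^ f := by
        refine dvd_trans (dvd_trans (dvd_pow_self 2 (by omega)) h) ?_
        rw [← pow_two]
        exact pow_dvd_pow x (by simpa using Nat.pow_le_pow_right (n := 2) (by norm_num) hf0)
      exact (dvd_sub_right h3).1 (two_dvd_pow_two_pow_sub_self hφ hf x)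
    obtain ⟨y, rfl⟩ := h1
    obtain ⟨c, hc⟩ := h
    obtain ⟨d, hd⟩ := ih y ⟨c, h2 _ _ (h2 _ _ (by linear_combination hc))⟩
    exact ⟨d, by rw [hd]; ring⟩

end FrobeniusLift

/-! ### Squaring, inversion and augmentation on ℤG. -/

section GroupRing

variable {G : Type*} [CommGroup G]

/-- The ring endomorphism `∑ a_g g ↦ ∑ a_g g²` of the integral group ring. -/
noncomputable def groupRingSq (G : Type*) [CommGroup G] :
    MonoidAlgebra ℤ G →+* MonoidAlgebra ℤ G :=
  mapDomainRingHom ℤ (powMonoidHom 2 : G →* G)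

/-- The ring endomorphism `∑ a_g g ↦ ∑ a_g g⁻¹` of the integral group ring. -/
noncomputable def groupRingInvHom (G : Type*) [CommGroup G] :
    MonoidAlgebra ℤ G →+* MonoidAlgebra ℤ G :=
  mapDomainRingHom ℤ (invMonoidHom : G →* G)

/-- The sum of the coefficients of an element of the integral group ring. -/
noncomputable def groupRingAug (G : Type*) [CommGroup G] : MonoidAlgebra ℤ G →+* ℤ :=
  (MonoidAlgebra.lift ℤ ℤ G (1 : G →* ℤ) : MonoidAlgebra ℤ G →ₐ[ℤ] ℤ)

@[simp]
theorem groupRingSq_single (g : G) (a : ℤ) : groupRingSq G (single g a) = single (g ^ 2) a := by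
  simp [groupRingSq]

@[simp]
theorem groupRingInvHom_single (g : G) (a : ℤ) :
    groupRingInvHom G (single g a) = single g⁻¹ a := by
  simp [groupRingInvHom]

@[simp]
theorem groupRingAug_single (g : G) (a : ℤ) : groupRingAug G (single g a) = a := by
  simp [groupRingAug]

theorem groupRingAug_eq_sum [Fintype G] (x : MonoidAlgebra ℤ G) :
    groupRingAug G x = ∑ g, x.coeff g := by
  induction x using MonoidAlgebra.induction_linear with
  | zero => simp
  | add x y hx hy => simp [hx, hy, Finset.sum_add_distrib]
  | single g a => classical simp [Finsupp.single_apply]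

theorem natCast_mul_left_cancel {n : ℕ} (hn : n ≠ 0) {x y : MonoidAlgebra ℤ G}
    (h : (n : MonoidAlgebra ℤ G) * x = n * y) : x = y := by
  rw [← nsmul_eq_mul, ← nsmul_eq_mul] at h
  ext g
  have := congrArg (fun z => z.coeff g) h
  rw [coeff_smul_apply, coeff_smul_apply, nsmul_eq_mul, nsmul_eq_mul] at this
  exact mul_left_cancel₀ (Nat.cast_ne_zero.2 hn) this

theorem two_mul_left_cancel (x y : MonoidAlgebra ℤ G) (h : 2 * x = 2 * y) : x = y :=
  natCast_mul_left_cancel two_ne_zero (by exact_mod_cast h)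

/-- Cross terms of a square are even, and a ≡ a ^ 2 modulo 2 for integer coefficients. This is the
Frobenius-lift hypothesis of the previous part. -/
theorem two_dvd_groupRingSq_sub_sq (x : MonoidAlgebra ℤ G) :
    (2 : MonoidAlgebra ℤ G) ∣ groupRingSq G x - x ^ 2 := by
  induction x using MonoidAlgebra.induction_linear with
  | zero => simp
  | add x y hx hy =>
    have : groupRingSq G (x + y) - (x + y) ^ 2 =
      (groupRingSq G x - x ^ 2) + (groupRingSq G y - y ^ 2) - 2 * (x * y) := by
      rw [map_add]; ring
    rw [this]
    exact dvd_sub (dvd_add hx hy) (dvd_mul_right _ _)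
  | single g a =>
    rw [groupRingSq_single, single_pow, ← single_sub]
    obtain ⟨b, hb⟩ : (2 : ℤ) ∣ a - a ^ 2 := by
      have := Int.even_mul_pred_self a
      rw [← even_iff_two_dvd, show a - a ^ 2 = -(a * (a - 1)) by ring]
      exact this.neg
    refine ⟨single (g ^ 2) b, ?_⟩
    rw [hb, ← Nat.cast_ofNat (R := MonoidAlgebra ℤ G), ← nsmul_eq_mul, smul_single]
    simp

theorem groupRingSq_iterate_single (n : ℕ) (g : G) (a : ℤ) :
    (groupRingSq G)^[n] (single g a) = single (g ^ 2 ^ n) a := by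
  induction n with
  | zero => simp
  | succ n ih => rw [Function.iterate_succ_apply', ih, groupRingSq_single, ← pow_mul, pow_succ]

theorem groupRingSq_iterate_eq_of_forall (n : ℕ) (ψ : MonoidAlgebra ℤ G →+* MonoidAlgebra ℤ G)
    (h : ∀ g a, ψ (single g a) = single (g ^ 2 ^ n) a) : (groupRingSq G)^[n] = ψ := by
  funext x
  induction x using MonoidAlgebra.induction_linear with
  | zero => simp [iterate_map_zero]
  | add x y hx hy => rw [iterate_map_add, hx, hy, map_add]
  | single g a => rw [groupRingSq_iterate_single, h]

theorem groupRingSq_iterate_totient [Finite G] (hG : Odd (Nat.card G)) :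
    (groupRingSq G)^[(Nat.card G).totient] = id := by
  rw [groupRingSq_iterate_eq_of_forall _ (RingHom.id _) fun g a => ?_]
  · rfl
  · have h := Nat.ModEq.pow_totient (x := 2) (n := Nat.card G)
      (Nat.coprime_two_left.2 hG)
    have hg : g ^ 2 ^ (Nat.card G).totient = g ^ 1 :=
      pow_eq_pow_iff_modEq.2 (h.of_dvd (orderOf_dvd_natCard g))
    rw [hg, pow_one, RingHom.id_apply]

/-- Since 2 ^ n acts on exponents as -1, inversion is the n-th iterate of squaring. -/
theorem groupRingInvHom_eq_self {n : ℕ} (hn : ∀ g : G, g ^ (2 ^ n + 1) = 1)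
    {x : MonoidAlgebra ℤ G} (hx : groupRingSq G x = x) : groupRingInvHom G x = x := by
  rw [← groupRingSq_iterate_eq_of_forall n (groupRingInvHom G) fun g a => ?_]
  · exact Function.iterate_fixed hx n
  · rw [groupRingInvHom_single, inv_eq_of_mul_eq_one_left (by rw [← pow_succ, hn])]

theorem two_pow_dvd_groupRingSq_mul [Finite G] (hG : Odd (Nat.card G)) (m : ℕ)
    (x y : MonoidAlgebra ℤ G) (h : (2 : MonoidAlgebra ℤ G) ^ m ∣ x * y) :
    (2 : MonoidAlgebra ℤ G) ^ m ∣ groupRingSq G x * y :=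
  two_pow_dvd_frobeniusLift_mul two_dvd_groupRingSq_sub_sq (groupRingSq_iterate_totient hG)
    (Nat.totient_pos.2 Nat.card_pos) two_mul_left_cancel m x y h

theorem groupRing_two_pow_dvd_of_mul_self [Finite G] (hG : Odd (Nat.card G)) (m : ℕ)
    (x : MonoidAlgebra ℤ G) (h : (2 : MonoidAlgebra ℤ G) ^ (2 * m) ∣ x * x) :
    (2 : MonoidAlgebra ℤ G) ^ m ∣ x :=
  two_pow_dvd_of_two_pow_dvd_mul_self two_dvd_groupRingSq_sub_sq (groupRingSq_iterate_totient hG)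
    (Nat.totient_pos.2 Nat.card_pos) two_mul_left_cancel m x h

theorem coeff_one_mul_groupRingInvHom [Fintype G] (x : MonoidAlgebra ℤ G) :
    (x * groupRingInvHom G x).coeff 1 = ∑ g, x.coeff g ^ 2 := by
  rw [coeff_mul_apply_left, Finsupp.sum_fintype _ _ (by simp)]
  refine Finset.sum_congr rfl fun g _ => ?_
  have : (groupRingInvHom G x).coeff (g⁻¹ * 1) = x.coeff g := by
    rw [mul_one]
    exact Finsupp.mapDomain_apply inv_injective _ _
  rw [this, sq]

/-- The only units `z` of `ℤG` with `z z^{(-1)} = 1` and coefficient sum `1` are the elements of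
the group. -/
theorem eq_single_of_mul_groupRingInvHom_eq_one [Finite G] {z : MonoidAlgebra ℤ G}
    (hz : z * groupRingInvHom G z = 1) (haug : groupRingAug G z = 1) : ∃ c, z = single c 1 := by
  classical
  cases nonempty_fintype G
  have h1 : ∑ g, z.coeff g ^ 2 = 1 := by
    rw [← coeff_one_mul_groupRingInvHom, hz, coeff_one_one]
  rw [groupRingAug_eq_sum] at haug
  -- Coefficients and their squares both sum to 1, and a ≤ a ^ 2 for every integer a, so equality
  -- holds termwise.
  have h01 : ∀ g, z.coeff g ^ 2 - z.coeff g = 0 := by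
    have h0 : ∑ g, (z.coeff g ^ 2 - z.coeff g) = 0 := by
      rw [Finset.sum_sub_distrib, h1, haug, sub_self]
    have := (Finset.sum_eq_zero_iff_of_nonneg fun g _ => sub_nonneg.2 (Int.le_self_sq _)).1 h0
    exact fun g => this g (Finset.mem_univ g)
  have h01' : ∀ g, z.coeff g = 0 ∨ z.coeff g = 1 := by
    intro g
    have : z.coeff g * (z.coeff g - 1) = 0 := by rw [← h01 g]; ring
    rcases mul_eq_zero.1 this with h | h
    · exact Or.inl h
    · exact Or.inr (by linarith)
  obtain ⟨c, -, hc⟩ := Finset.exists_ne_zero_of_sum_ne_zero (haug.trans_ne one_ne_zero)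
  have hc1 : z.coeff c = 1 := (h01' c).resolve_left hc
  refine ⟨c, ?_⟩
  ext g
  rw [coeff_single, Finsupp.single_apply]
  split_ifs with h
  · rw [← h, hc1]
  · rw [← Finset.add_sum_erase _ _ (Finset.mem_univ c), hc1] at haug
    have h0 : ∑ g ∈ Finset.univ.erase c, z.coeff g = 0 := by linarith
    refine (Finset.sum_eq_zero_iff_of_nonneg fun g _ => ?_).1 h0 g (by simp [Ne.symm h])
    rcases h01' g with h | h <;> simp [h]

theorem eq_one_of_groupRingSq_eq_self [Finite G] {z : MonoidAlgebra ℤ G}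
    (hz : z * groupRingInvHom G z = 1) (haug : groupRingAug G z = 1)
    (hsq : groupRingSq G z = z) : z = 1 := by
  obtain ⟨c, rfl⟩ := eq_single_of_mul_groupRingInvHom_eq_one hz haug
  rw [groupRingSq_single, single_left_inj one_ne_zero, sq, mul_eq_left] at hsq
  rw [hsq, one_def]

end GroupRing

/-! ### Group ring elements of subsets and their images in quotients. -/

section SubsetElements

variable {G H : Type*} [CommGroup G] [CommGroup H]

theorem coeff_mapDomain_groupRingElt {G X : Type*} [Group G] [Finite G] (f : G → X) (S : Set G)
    (c : X) :
    (mapDomain f (groupRingElt S)).coeff c = ((S ∩ f ⁻¹' {c}).ncard : ℤ) := by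
  classical
  have hS : S.Finite := S.toFinite
  have e : S ∩ f ⁻¹' {c} = ↑(hS.toFinset.filter fun g => f g = c) := by
    ext; simp
  rw [groupRingElt, finsum_mem_eq_finite_toFinset_sum _ hS, e, Set.ncard_coe_finset]
  have : mapDomain f (∑ g ∈ hS.toFinset, single g (1 : ℤ)) =
      ∑ g ∈ hS.toFinset, single (f g) (1 : ℤ) := by
    induction hS.toFinset using Finset.induction_on with
    | empty => simp
    | insert a s ha ih => rw [Finset.sum_insert ha, mapDomain_add, ih, Finset.sum_insert ha,
        mapDomain_single]
  rw [this, coeff_sum, Finsupp.finsetSum_apply, Finset.card_filter]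
  simp [Finsupp.single_apply]

theorem coeff_groupRingElt [Finite G] (S : Set G) (c : G) [Decidable (c ∈ S)] :
    (groupRingElt S).coeff c = if c ∈ S then 1 else 0 := by
  have h := coeff_mapDomain_groupRingElt id S c
  have h' : mapDomain id (groupRingElt S) = groupRingElt S := by ext; simp
  rw [h'] at h
  rw [h]
  split_ifs with hc
  · rw [show S ∩ id ⁻¹' {c} = {c} by ext; simp; rintro rfl; exact hc]; simp
  · rw [show S ∩ id ⁻¹' {c} = ∅ by ext; simp; intro h h'; exact hc (h' ▸ h)]; simp

theorem groupRingElt_injective [Finite G] :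
    Function.Injective (groupRingElt : Set G → MonoidAlgebra ℤ G) := by
  classical
  intro S T h
  ext g
  have := congrArg (fun z => z.coeff g) h
  simp only [coeff_groupRingElt] at this
  by_cases h1 : g ∈ S <;> by_cases h2 : g ∈ T <;> simp_all

theorem mapDomain_groupRingElt_of_injective [Finite G] [Finite H] {f : G → H}
    (hf : Function.Injective f) (S : Set G) :
    mapDomain f (groupRingElt S) = groupRingElt (f '' S) := by
  classical
  ext c
  rw [coeff_mapDomain_groupRingElt, coeff_groupRingElt]
  split_ifs with hc
  · obtain ⟨g, hg, rfl⟩ := hc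
    rw [show S ∩ f ⁻¹' {f g} = {g} by
      ext x; simp only [Set.mem_inter_iff, Set.mem_preimage, Set.mem_singleton_iff, hf.eq_iff]
      constructor
      · exact And.right
      · rintro rfl; exact ⟨hg, rfl⟩]
    simp
  · rw [show S ∩ f ⁻¹' {c} = ∅ by
      ext x; simp only [Set.mem_inter_iff, Set.mem_preimage, Set.mem_singleton_iff,
        Set.mem_empty_iff_false, iff_false, not_and]
      rintro h rfl; exact hc ⟨x, h, rfl⟩]
    simp

theorem groupRingAug_groupRingElt [Finite G] (S : Set G) :
    groupRingAug G (groupRingElt S) = S.ncard := by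
  classical
  cases nonempty_fintype G
  simp [groupRingAug_eq_sum, coeff_groupRingElt, Set.ncard_eq_toFinset_card']

theorem coeff_groupRingElt_univ [Finite G] (c : G) :
    (groupRingElt (Set.univ : Set G)).coeff c = 1 := by
  classical
  simp [coeff_groupRingElt]

theorem single_mul_groupRingElt [Finite G] (g : G) (S : Set G) :
    single g 1 * groupRingElt S = groupRingElt ((g * ·) '' S) := by
  rw [← mapDomain_groupRingElt_of_injective (mul_right_injective g)]
  induction groupRingElt S using MonoidAlgebra.induction_linear with
  | zero => simp
  | add x y hx hy => rw [mul_add, hx, hy, mapDomain_add]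
  | single h a => simp [single_mul_single]

theorem mul_groupRingElt_univ [Finite G] (x : MonoidAlgebra ℤ G) :
    x * groupRingElt Set.univ =
      (groupRingAug G x : MonoidAlgebra ℤ G) * groupRingElt (Set.univ : Set G) := by
  induction x using MonoidAlgebra.induction_linear with
  | zero => simp
  | add x y hx hy => rw [add_mul, hx, hy, map_add, Int.cast_add, add_mul]
  | single g a =>
    rw [groupRingAug_single, show single g a = (a : MonoidAlgebra ℤ G) * single g 1 by
      rw [← zsmul_eq_mul, smul_single]; simp, mul_assoc, single_mul_groupRingElt]
    congr 2
    exact Set.image_univ_of_surjective (mul_left_surjective g)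

theorem mapDomain_groupRingElt_univ_of_bijective [Finite G] [Finite H] {f : G → H}
    (hf : Function.Bijective f) :
    mapDomain f (groupRingElt (Set.univ : Set G)) = groupRingElt Set.univ := by
  rw [mapDomain_groupRingElt_of_injective hf.1, Set.image_univ_of_surjective hf.2]

theorem groupRingInvHom_groupRingElt_univ [Finite G] :
    groupRingInvHom G (groupRingElt Set.univ) = groupRingElt Set.univ :=
  mapDomain_groupRingElt_univ_of_bijective inv_involutive.bijective

theorem groupRingSq_groupRingElt_univ [Finite G] (hG : Odd (Nat.card G)) :
    groupRingSq G (groupRingElt Set.univ) = groupRingElt Set.univ :=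
  mapDomain_groupRingElt_univ_of_bijective (powCoprime (Nat.coprime_two_right.2 hG)).bijective

theorem groupRingAug_mapDomain (f : G → H) (x : MonoidAlgebra ℤ G) :
    groupRingAug H (mapDomain f x) = groupRingAug G x := by
  induction x using MonoidAlgebra.induction_linear with
  | zero => simp
  | add x y hx hy => rw [mapDomain_add, map_add, map_add, hx, hy]
  | single g a => simp

theorem groupRingSq_mapDomain (f : G →* H) (x : MonoidAlgebra ℤ G) :
    groupRingSq H (mapDomain f x) = mapDomain f (groupRingSq G x) := by
  induction x using MonoidAlgebra.induction_linear with
  | zero => simp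
  | add x y hx hy => rw [mapDomain_add, map_add, map_add, hx, hy, mapDomain_add]
  | single g a => simp

theorem groupRingInvHom_mapDomain (f : G →* H) (x : MonoidAlgebra ℤ G) :
    groupRingInvHom H (mapDomain f x) = mapDomain f (groupRingInvHom G x) := by
  induction x using MonoidAlgebra.induction_linear with
  | zero => simp
  | add x y hx hy => rw [mapDomain_add, map_add, map_add, hx, hy, mapDomain_add]
  | single g a => simp

/-- The image of the sum of all elements of `G` under a surjection with kernel of order `n`. -/
theorem mapDomain_groupRingElt_univ [Finite G] [Finite H] (f : G →* H)
    (hf : Function.Surjective f) {n : ℕ} (hn : Nat.card H * n = Nat.card G) :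
    mapDomain f (groupRingElt (Set.univ : Set G)) =
      (n : MonoidAlgebra ℤ H) * groupRingElt Set.univ := by
  cases nonempty_fintype H
  set y := mapDomain f (groupRingElt (Set.univ : Set G)) with hy
  have hconst : ∀ c, y.coeff c = y.coeff 1 := by
    intro c
    obtain ⟨g, rfl⟩ := hf c
    have h1 : single (f g) 1 * y = y := by
      rw [hy, ← mapDomain_single, ← mapDomain_mul, single_mul_groupRingElt,
        Set.image_univ_of_surjective (mul_left_surjective g)]
    have := congrArg (fun z => z.coeff (f g)) h1
    simp only [coeff_single_mul_apply] at this
    simpa using this.symm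
  have haug : groupRingAug H y = Nat.card G := by
    rw [hy, groupRingAug_mapDomain, groupRingAug_groupRingElt, Set.ncard_univ]
  rw [groupRingAug_eq_sum, Finset.sum_congr rfl fun c _ => hconst c, Finset.sum_const,
    Finset.card_univ, ← Nat.card_eq_fintype_card, ← hn, nsmul_eq_mul, Nat.cast_mul] at haug
  have h1 := mul_left_cancel₀ (Nat.cast_ne_zero.2 Nat.card_pos.ne') haug
  ext c
  rw [hconst, h1, ← nsmul_eq_mul, coeff_smul_apply, coeff_groupRingElt_univ]
  simp

/-- The order identity of a difference set, stated with `groupRingInvHom`. -/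
theorem IsDifferenceSet.mul_groupRingInvHom [Finite G] {D : Set G} {v k l : ℕ}
    (hD : IsDifferenceSet D v k l) :
    groupRingElt D * groupRingInvHom G (groupRingElt D) =
      (l : MonoidAlgebra ℤ G) * groupRingElt Set.univ +
        ((k : MonoidAlgebra ℤ G) - (l : MonoidAlgebra ℤ G)) := by
  have h := hD.2.2.2
  rw [zsmul_eq_mul, zsmul_eq_mul, mul_one] at h
  push_cast at h
  exact h

end SubsetElements

/-! ### The multiplier 2 and the images of D in the two quotients. -/

section ProjectiveParameters

variable {G H : Type*} [CommGroup G] [CommGroup H]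

@[simp]
theorem groupRingAug_groupRingInvHom (x : MonoidAlgebra ℤ G) :
    groupRingAug G (groupRingInvHom G x) = groupRingAug G x :=
  groupRingAug_mapDomain (fun g : G => g⁻¹) x

variable [Finite G] [Finite H]

/-- `2` is a multiplier of a difference set with the parameters of `PG(3, 2^s)`. -/
theorem exists_groupRingSq_eq_single_mul {s q : ℕ} (hq : q = 2 ^ s) {D : Set G}
    (hD : IsDifferenceSet D (q ^ 3 + q ^ 2 + q + 1) (q ^ 2 + q + 1) (q + 1))
    (hG : Odd (Nat.card G)) :
    ∃ c : G, groupRingSq G (groupRingElt D) = single c 1 * groupRingElt D := by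
  have hq0 : q ≠ 0 := by rw [hq]; positivity
  have hDD := hD.mul_groupRingInvHom
  have hinvU := groupRingInvHom_groupRingElt_univ (G := G)
  have hsqU := groupRingSq_groupRingElt_univ hG
  have hcard := hD.1
  have hsqaug : groupRingAug G (groupRingSq G (groupRingElt D)) = (q ^ 2 + q + 1 : ℕ) := by
    rw [← hD.2.1, ← groupRingAug_groupRingElt]
    exact groupRingAug_mapDomain _ _
  have haug : groupRingAug G (groupRingElt D) = (q ^ 2 + q + 1 : ℕ) := by
    rw [groupRingAug_groupRingElt, hD.2.1]
  have hUaug : groupRingAug G (groupRingElt (Set.univ : Set G)) = (q ^ 3 + q ^ 2 + q + 1 : ℕ) := by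
    rw [groupRingAug_groupRingElt, Set.ncard_univ, hcard]
  have hU := mul_groupRingElt_univ (G := G)
  set U : MonoidAlgebra ℤ G := groupRingElt Set.univ
  set d := groupRingElt D
  set e := groupRingSq G d with he
  set d' := groupRingInvHom G d with hd'
  set Q : MonoidAlgebra ℤ G := (q : MonoidAlgebra ℤ G) with hQ
  have hDU : d * U = (Q ^ 2 + Q + 1) * U := by rw [hU, haug]; push_cast; rfl
  have hDU' : d' * U = (Q ^ 2 + Q + 1) * U := by
    rw [hU, groupRingAug_groupRingInvHom, haug]; push_cast; rfl
  have hEU : e * U = (Q ^ 2 + Q + 1) * U := by rw [hU, hsqaug]; push_cast; rfl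
  have hUU : U * U = (Q ^ 3 + Q ^ 2 + Q + 1) * U := by rw [hU, hUaug]; push_cast; rfl
  have hDD' : d * d' = (Q + 1) * U + Q ^ 2 := by rw [hDD]; push_cast; ring
  have h2 : (2 : MonoidAlgebra ℤ G) ^ (2 * s) = Q ^ 2 := by
    rw [hQ, hq, mul_comm, pow_mul]; push_cast; rfl
  -- Shifting by U makes the whole product divisible: (d - U)(d' - U) = q ^ 2 (1 + (q - 1) U).
  obtain ⟨w, hw⟩ : (2 : MonoidAlgebra ℤ G) ^ (2 * s) ∣ groupRingSq G (d - U) * (d' - U) := by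
    refine two_pow_dvd_groupRingSq_mul hG _ _ _ ⟨1 + (Q - 1) * U, ?_⟩
    rw [h2]
    linear_combination hDD' - hDU - hDU' + hUU
  rw [map_sub, hsqU, ← he, h2] at hw
  obtain ⟨z, hz⟩ : ∃ z, e * d' = (Q + 1) * U + Q ^ 2 * z :=
    ⟨w - (Q - 1) * U, by linear_combination hw + hEU + hDU' - hUU⟩
  have hzaug : groupRingAug G z = 1 := by
    have := congrArg (groupRingAug G) hz
    rw [map_mul, groupRingAug_groupRingInvHom, haug, hsqaug, map_add, map_mul, map_mul, map_add,
      map_pow, hUaug, map_natCast, map_one] at this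
    have hq2 : (q : ℤ) ^ 2 ≠ 0 := by positivity
    refine mul_left_cancel₀ hq2 ?_
    push_cast at this
    linear_combination -this
  have hzU : z * U = U := by rw [hU, hzaug, Int.cast_one, one_mul]
  have hzU' : groupRingInvHom G z * U = U := by
    rw [hU, groupRingAug_groupRingInvHom, hzaug, Int.cast_one, one_mul]
  have hz' : groupRingInvHom G e * d = (Q + 1) * U + Q ^ 2 * groupRingInvHom G z := by
    have := congrArg (groupRingInvHom G) hz
    rw [map_mul, map_add, map_mul, map_mul, map_add, map_pow, hinvU, map_natCast, map_one] at this
    rw [← this, hd']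
    congr 1
    change d = mapDomain _ (mapDomain _ d)
    ext; simp [← Finsupp.mapDomain_comp]
  have hEE : e * groupRingInvHom G e = (Q + 1) * U + Q ^ 2 := by
    have := congrArg (groupRingSq G) hDD'
    rw [map_mul, map_add, map_mul, map_add, map_pow, hsqU, map_natCast, map_one] at this
    rw [← this, he, hd']
    congr 1
    exact (groupRingSq_mapDomain (invMonoidHom : G →* G) d).symm
  -- Compute (e d')(e^{(-1)} d) in two ways: regrouped as (e e^{(-1)})(d d'), and through z.
  have hzz : z * groupRingInvHom G z = 1 := by
    refine natCast_mul_left_cancel (n := q ^ 4) (by positivity) ?_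
    push_cast
    rw [← hQ]
    have h1 : (e * d') * (groupRingInvHom G e * d) = ((Q + 1) * U + Q ^ 2) ^ 2 := by
      linear_combination d * d' * hEE + ((Q + 1) * U + Q ^ 2) * hDD'
    rw [hz, hz'] at h1
    linear_combination h1 - (Q + 1) * Q ^ 2 * (hzU + hzU')
  obtain ⟨c, rfl⟩ := eq_single_of_mul_groupRingInvHom_eq_one hzz hzaug
  refine ⟨c, natCast_mul_left_cancel (n := q ^ 2) (by positivity) ?_⟩
  push_cast
  linear_combination d * hz - e * hDD' - (Q + 1) * hEU + (Q + 1) * hDU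

/-- A normalized difference set with the parameters of `PG(3, 2^s)` is closed under squaring. -/
theorem IsNormalized.groupRingSq_groupRingElt {s q : ℕ} (hq : q = 2 ^ s) {D : Set G}
    (hD : IsDifferenceSet D (q ^ 3 + q ^ 2 + q + 1) (q ^ 2 + q + 1) (q + 1))
    (hG : Odd (Nat.card G)) (hnorm : IsNormalized D) :
    groupRingSq G (groupRingElt D) = groupRingElt D := by
  obtain ⟨c, hc⟩ := exists_groupRingSq_eq_single_mul hq hD hG
  have hinj : Function.Injective fun g : G => g ^ 2 :=
    (powCoprime (Nat.coprime_two_right.2 hG)).injective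
  have hset : (fun g : G => g ^ 2) '' D = (c * ·) '' D := by
    apply groupRingElt_injective
    rw [← single_mul_groupRingElt, ← hc, ← mapDomain_groupRingElt_of_injective hinj]
    rfl
  have hfin : D.Finite := D.toFinite
  have h1 : ∏ᶠ g ∈ (fun g : G => g ^ 2) '' D, g = 1 := by
    rw [finprod_mem_image hinj.injOn]
    simp only [sq]
    rw [finprod_mem_mul_distrib hfin, hnorm, one_mul]
  have h2 : ∏ᶠ g ∈ (c * ·) '' D, g = c ^ D.ncard := by
    rw [finprod_mem_image (mul_right_injective c).injOn, finprod_mem_mul_distrib hfin, hnorm,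
      mul_one, finprod_mem_eq_finite_toFinset_prod _ hfin, Finset.prod_const,
      Set.ncard_eq_toFinset_card D hfin]
  have hck : c ^ (q ^ 2 + q + 1) = 1 := by rw [← hD.2.1, ← h2, ← hset, h1]
  have hcv : c ^ (q ^ 3 + q ^ 2 + q + 1) = 1 := by rw [← hD.1, pow_card_eq_one']
  -- Comparing products over D ^ 2 = c D gave c ^ |D| = 1; since |G| = q |D| + 1, also c ^ |G| = 1
  -- forces c = 1.
  have hc1 : c = 1 := by
    have : q ^ 3 + q ^ 2 + q + 1 = (q ^ 2 + q + 1) * q + 1 := by ring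
    rwa [this, pow_succ, pow_mul, hck, one_pow, one_mul] at hcv
  rw [hc, hc1, ← one_def, one_mul]

/-- Square roots in `ℤG` of elements with the form of `D D^{(-1)}` are real when `2` is a
multiplier and a power of `2` is `-1` modulo the exponent; such a root is determined modulo
`2 ^ s`. -/
theorem exists_eq_groupRingElt_univ_add {s j : ℕ} (hG : Odd (Nat.card G))
    (hj : ∀ g : G, g ^ (2 ^ j + 1) = 1) {x w : MonoidAlgebra ℤ G} (hx : groupRingSq G x = x)
    (hxw : (x - groupRingElt Set.univ) * (groupRingInvHom G x - groupRingElt Set.univ) =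
      (2 ^ s) ^ 2 * w) :
    ∃ y, x = groupRingElt Set.univ + 2 ^ s * y ∧ groupRingSq G y = y ∧ groupRingInvHom G y = y ∧
      y * y = w := by
  -- Once x is fixed by inversion, the left side of `hxw` is the square of x - U.
  have hinv := groupRingInvHom_eq_self hj hx
  rw [hinv, ← pow_mul, mul_comm s] at hxw
  obtain ⟨y, hy⟩ := groupRing_two_pow_dvd_of_mul_self hG s _ ⟨w, hxw⟩
  have h2 : ∀ a b : MonoidAlgebra ℤ G, 2 ^ s * a = 2 ^ s * b → a = b := fun a b h =>
    natCast_mul_left_cancel (n := 2 ^ s) (by positivity) (by exact_mod_cast h)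
  have hsq : groupRingSq G y = y := by
    have := congrArg (groupRingSq G) hy
    rw [map_sub, hx, groupRingSq_groupRingElt_univ hG, map_mul, map_pow, map_ofNat, hy] at this
    exact (h2 _ _ this).symm
  refine ⟨y, by rw [← hy]; ring, hsq, groupRingInvHom_eq_self hj hsq, h2 _ _ (h2 _ _ ?_)⟩
  rw [hy] at hxw
  linear_combination hxw

/-- The image of a difference set with the parameters of `PG(3, q)`, `q = 2^s`, in a quotient of
order `q + 1`. -/
theorem mapDomain_eq_of_card_eq_add_one {s q : ℕ} (hq : q = 2 ^ s) {D : Set G}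
    (hD : IsDifferenceSet D (q ^ 3 + q ^ 2 + q + 1) (q ^ 2 + q + 1) (q + 1))
    (hsq : groupRingSq G (groupRingElt D) = groupRingElt D) (f : G →* H)
    (hf : Function.Surjective f) (hH : Nat.card H = q + 1) (hodd : Odd (Nat.card H)) :
    mapDomain f (groupRingElt D) + (q : MonoidAlgebra ℤ H) =
      ((q + 1 : ℕ) : MonoidAlgebra ℤ H) * groupRingElt Set.univ := by
  have hUf := mapDomain_groupRingElt_univ f hf (n := q ^ 2 + 1) (by rw [hH, hD.1]; ring)
  have hDD := congrArg (mapDomainRingHom ℤ f) hD.mul_groupRingInvHom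
  have haug : groupRingAug H (mapDomain f (groupRingElt D)) = (q ^ 2 + q + 1 : ℕ) := by
    rw [groupRingAug_mapDomain, groupRingAug_groupRingElt, hD.2.1]
  have hxsq : groupRingSq H (mapDomain f (groupRingElt D)) = mapDomain f (groupRingElt D) := by
    rw [groupRingSq_mapDomain, hsq]
  rw [map_mul, map_add, map_mul, map_sub, map_natCast, map_natCast] at hDD
  change mapDomain f _ * mapDomain f _ = _ * mapDomain f _ + _ at hDD
  rw [← groupRingInvHom_mapDomain, hUf] at hDD
  have hU := mul_groupRingElt_univ (G := H)
  have hUaug : groupRingAug H (groupRingElt (Set.univ : Set H)) = (q + 1 : ℕ) := by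
    rw [groupRingAug_groupRingElt, Set.ncard_univ, hH]
  have hinvU := groupRingInvHom_groupRingElt_univ (G := H)
  have hsqU := groupRingSq_groupRingElt_univ hodd
  have hj : ∀ g : H, g ^ (2 ^ s + 1) = 1 := fun g => by rw [← hq, ← hH, pow_card_eq_one']
  have key := fun w => exists_eq_groupRingElt_univ_add (s := s) (w := w) hodd hj hxsq
  have h2 : (2 : MonoidAlgebra ℤ H) ^ s = q := by rw [hq]; push_cast; rfl
  set U : MonoidAlgebra ℤ H := groupRingElt Set.univ
  set x := mapDomain f (groupRingElt D)
  set Q : MonoidAlgebra ℤ H := (q : MonoidAlgebra ℤ H) with hQ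
  have hxU : x * U = (Q ^ 2 + Q + 1) * U := by rw [hU, haug]; push_cast; rfl
  have hxU' : groupRingInvHom H x * U = (Q ^ 2 + Q + 1) * U := by
    rw [hU, groupRingAug_groupRingInvHom, haug]; push_cast; rfl
  have hUU : U * U = (Q + 1) * U := by rw [hU, hUaug]; push_cast; rfl
  obtain ⟨y, hy, hysq, hyinv, hyy⟩ := key (1 + (Q - 1) * U) (by
    push_cast at hDD
    rw [h2]
    linear_combination hDD - hxU - hxU' + hUU)
  rw [h2] at hy
  have hyaug : groupRingAug H y = q := by
    have := congrArg (groupRingAug H) hy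
    rw [haug, map_add, map_mul, hUaug, map_natCast] at this
    have hq0 : (q : ℤ) ≠ 0 := by rw [hq]; positivity
    refine mul_left_cancel₀ hq0 ?_
    push_cast at this
    linear_combination -this
  have hyU : y * U = Q * U := by rw [hU, hyaug]; push_cast; rfl
  -- Here y * y = 1 + (q - 1) U, so y itself is not the unit sought; U - y has square 1 and
  -- coefficient sum 1.
  have h1 : U - y = 1 := by
    refine eq_one_of_groupRingSq_eq_self ?_ ?_ ?_
    · rw [map_sub, hinvU, hyinv]
      linear_combination hUU - 2 * hyU + hyy
    · rw [map_sub, hyaug, hUaug]; push_cast; ring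
    · rw [map_sub, hsqU, hysq]
  push_cast
  linear_combination hy - Q * h1

/-- The image of a difference set with the parameters of `PG(3, q)`, `q = 2^s`, in a quotient of
order `q ^ 2 + 1`. -/
theorem mapDomain_eq_of_card_eq_sq_add_one {s q : ℕ} (hq : q = 2 ^ s) {D : Set G}
    (hD : IsDifferenceSet D (q ^ 3 + q ^ 2 + q + 1) (q ^ 2 + q + 1) (q + 1))
    (hsq : groupRingSq G (groupRingElt D) = groupRingElt D) (f : G →* H)
    (hf : Function.Surjective f) (hH : Nat.card H = q ^ 2 + 1) (hodd : Odd (Nat.card H)) :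
    mapDomain f (groupRingElt D) = groupRingElt Set.univ + (q : MonoidAlgebra ℤ H) := by
  have hUf := mapDomain_groupRingElt_univ f hf (n := q + 1) (by rw [hH, hD.1]; ring)
  have hDD := congrArg (mapDomainRingHom ℤ f) hD.mul_groupRingInvHom
  have haug : groupRingAug H (mapDomain f (groupRingElt D)) = (q ^ 2 + q + 1 : ℕ) := by
    rw [groupRingAug_mapDomain, groupRingAug_groupRingElt, hD.2.1]
  have hxsq : groupRingSq H (mapDomain f (groupRingElt D)) = mapDomain f (groupRingElt D) := by
    rw [groupRingSq_mapDomain, hsq]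
  rw [map_mul, map_add, map_mul, map_sub, map_natCast, map_natCast] at hDD
  change mapDomain f _ * mapDomain f _ = _ * mapDomain f _ + _ at hDD
  rw [← groupRingInvHom_mapDomain, hUf] at hDD
  have hU := mul_groupRingElt_univ (G := H)
  have hUaug : groupRingAug H (groupRingElt (Set.univ : Set H)) = (q ^ 2 + 1 : ℕ) := by
    rw [groupRingAug_groupRingElt, Set.ncard_univ, hH]
  have hj : ∀ g : H, g ^ (2 ^ (s * 2) + 1) = 1 := fun g => by
    rw [pow_mul, ← hq, ← hH, pow_card_eq_one']
  have key := fun w => exists_eq_groupRingElt_univ_add (s := s) (w := w) hodd hj hxsq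
  have h2 : (2 : MonoidAlgebra ℤ H) ^ s = q := by rw [hq]; push_cast; rfl
  set U : MonoidAlgebra ℤ H := groupRingElt Set.univ
  set x := mapDomain f (groupRingElt D)
  set Q : MonoidAlgebra ℤ H := (q : MonoidAlgebra ℤ H) with hQ
  have hxU : x * U = (Q ^ 2 + Q + 1) * U := by rw [hU, haug]; push_cast; rfl
  have hxU' : groupRingInvHom H x * U = (Q ^ 2 + Q + 1) * U := by
    rw [hU, groupRingAug_groupRingInvHom, haug]; push_cast; rfl
  have hUU : U * U = (Q ^ 2 + 1) * U := by rw [hU, hUaug]; push_cast; rfl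
  -- In this quotient all multiples of U cancel, leaving (x - U) ^ 2 = q ^ 2.
  obtain ⟨y, hy, hysq, hyinv, hyy⟩ := key 1 (by
    push_cast at hDD
    rw [h2]
    linear_combination hDD - hxU - hxU' + hUU)
  rw [h2] at hy
  have hyaug : groupRingAug H y = 1 := by
    have := congrArg (groupRingAug H) hy
    rw [haug, map_add, map_mul, hUaug, map_natCast] at this
    have hq0 : (q : ℤ) ≠ 0 := by rw [hq]; positivity
    refine mul_left_cancel₀ hq0 ?_
    push_cast at this
    linear_combination -this
  have h1 : y = 1 := eq_one_of_groupRingSq_eq_self (by rw [hyinv, hyy]) hyaug hysq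
  rw [hy, h1, mul_one]

end ProjectiveParameters

/-! ### The (15, 7, 3)-difference set in the cyclic group of order 15. -/

section Fifteen

theorem groupRingElt_coe_finset {G : Type*} [Group G] [Finite G] (S : Finset G) :
    groupRingElt (S : Set G) = ∑ g ∈ S, single g (1 : ℤ) :=
  finsum_mem_coe_finset _ _

/-- The points of `PG(3, 2)` lying on a plane, as powers of a Singer cycle. -/
theorem isDifferenceSet_pow_image {G : Type*} [CommGroup G] [Finite G] (hG : Nat.card G = 15)
    {g : G} (hg : orderOf g = 15) :
    IsDifferenceSet ((g ^ ·) '' ({0, 1, 2, 4, 5, 8, 10} : Set ℕ)) 15 7 3 := by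
  classical
  have hinj : Set.InjOn (g ^ · : ℕ → G) (Set.Iio 15) := hg ▸ pow_injOn_Iio_orderOf
  have hI : (({0, 1, 2, 4, 5, 8, 10} : Finset ℕ) : Set ℕ) ⊆ Set.Iio 15 := by
    intro i; simp; omega
  have hR : ((Finset.range 15 : Finset ℕ) : Set ℕ) ⊆ Set.Iio 15 := by
    intro i; simp
  have hset : ((g ^ ·) '' ({0, 1, 2, 4, 5, 8, 10} : Set ℕ)) =
      ((Finset.image (g ^ · : ℕ → G) {0, 1, 2, 4, 5, 8, 10} : Finset G) : Set G) := by
    simp [Set.image_insert_eq]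
  have huniv : (Set.univ : Set G) =
      ((Finset.image (g ^ · : ℕ → G) (Finset.range 15) : Finset G) : Set G) := by
    symm
    apply Set.eq_of_subset_of_ncard_le (Set.subset_univ _)
    rw [Set.ncard_univ, hG, Set.ncard_coe_finset, Finset.card_image_of_injOn (hinj.mono hR)]
    simp
  have hXpow : ∀ n, single (g ^ n) (1 : ℤ) = (single g 1 : MonoidAlgebra ℤ G) ^ n := fun n => by
    rw [single_pow, one_pow]
  have hX : (single g 1 : MonoidAlgebra ℤ G) ^ 15 = 1 := by
    rw [← hXpow, ← hg, pow_orderOf_eq_one, one_def]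
  have hXinv : ∀ n ≤ 15, groupRingInvHom G (single (g ^ n) 1) = (single g 1) ^ (15 - n) :=
    fun n hn => by
      rw [groupRingInvHom_single, ← hXpow, inv_eq_of_mul_eq_one_left]
      rw [← pow_add, Nat.sub_add_cancel hn, ← hg, pow_orderOf_eq_one]
  refine ⟨hG, ?_, by norm_num, ?_⟩
  · rw [hset, Set.ncard_coe_finset, Finset.card_image_of_injOn (hinj.mono hI)]
    rfl
  · have hD : groupRingElt ((g ^ ·) '' ({0, 1, 2, 4, 5, 8, 10} : Set ℕ)) =
        ∑ i ∈ ({0, 1, 2, 4, 5, 8, 10} : Finset ℕ), single (g ^ i) (1 : ℤ) := by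
      rw [hset, groupRingElt_coe_finset, Finset.sum_image (hinj.mono hI)]
    have hU : groupRingElt (Set.univ : Set G) =
        ∑ i ∈ Finset.range 15, single (g ^ i) (1 : ℤ) := by
      rw [huniv, groupRingElt_coe_finset, Finset.sum_image (hinj.mono hR)]
    change _ * groupRingInvHom G _ = _
    rw [hU, hD, map_sum]
    rw [Finset.sum_congr rfl fun i hi => hXinv i (le_of_lt (hI hi))]
    simp only [hXpow, zsmul_eq_mul]
    generalize (single g 1 : MonoidAlgebra ℤ G) = X at hX
    simp [Finset.sum_range_succ]
    -- The multiplier is the polynomial quotient by X ^ 15 - 1 of the difference of the two sides,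
    -- inverses being written X ^ (15 - i).
    linear_combination (7 + 3 * X + 3 * X ^ 2 + 3 * X ^ 3 + 3 * X ^ 4 +
      2 * X ^ 5 + 2 * X ^ 6 + X ^ 7 + 2 * X ^ 8 + X ^ 9 + X ^ 10) * hX

end Fifteen

/-! ### Complementary subgroups of coprime order. -/

section Subgroups

variable {G : Type*} [CommGroup G] [Finite G]

/-- By Cauchy, the kernel of the m-th power map has order coprime to n and its range order coprime
to m; the two orders multiply to m n. -/
theorem card_powMonoidHom_ker {m n : ℕ} (hmn : m.Coprime n) (hG : Nat.card G = m * n) :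
    Nat.card (powMonoidHom m : G →* G).ker = m := by
  have hcop : ∀ (a b : ℕ) (K : Subgroup G), a.Coprime b → (∀ x ∈ K, x ^ a = 1) →
      (Nat.card K).Coprime b := by
    intro a b K hab hK
    refine Nat.coprime_of_dvd fun p hp hpK hpb => ?_
    have := Fact.mk hp
    obtain ⟨x, hx⟩ := exists_prime_orderOf_dvd_card' p hpK
    have : p ∣ a := hx ▸ orderOf_dvd_of_pow_eq_one (Subtype.ext (by simpa using hK x x.2))
    exact hp.one_lt.ne' (Nat.eq_one_of_dvd_coprimes hab this hpb)
  set f : G →* G := powMonoidHom m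
  have h1 := hcop m n f.ker hmn fun x hx => hx
  have h2 := hcop n m f.range hmn.symm fun x hx => by
    obtain ⟨y, rfl⟩ := hx
    change (y ^ m) ^ n = 1
    rw [← pow_mul, ← hG, pow_card_eq_one']
  have h3 : Nat.card f.range * Nat.card f.ker = m * n := by
    rw [← hG, Subgroup.card_eq_card_quotient_mul_card_subgroup f.ker,
      Nat.card_congr (QuotientGroup.quotientKerEquivRange f).toEquiv]
  refine Nat.dvd_antisymm (h1.dvd_of_dvd_mul_right (h3 ▸ dvd_mul_left _ _)) ?_
  exact h2.symm.dvd_of_dvd_mul_left (h3 ▸ dvd_mul_right _ _)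

theorem card_quotient_powMonoidHom_ker {m n : ℕ} (hmn : m.Coprime n) (hG : Nat.card G = m * n) :
    Nat.card (G ⧸ (powMonoidHom m : G →* G).ker) = n := by
  have h := Subgroup.card_eq_card_quotient_mul_card_subgroup (powMonoidHom m : G →* G).ker
  rw [card_powMonoidHom_ker hmn hG, hG, mul_comm] at h
  have hm : 0 < m := Nat.pos_of_ne_zero fun h0 => by
    have := Nat.card_pos (α := G); simp [hG, h0] at this
  exact (Nat.eq_of_mul_eq_mul_right hm h).symm

end Subgroups

/-! ### Intersections of D with B and with the cosets of A. -/

section Structure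

variable {G : Type*} [CommGroup G] [Finite G] {s q : ℕ} {D : Set G}

theorem mem_pow_two_pow_of_groupRingSq (hsq : groupRingSq G (groupRingElt D) = groupRingElt D)
    (hG : Odd (Nat.card G)) (n : ℕ) {g : G} (hg : g ∈ D) : g ^ 2 ^ n ∈ D := by
  have hinj : Function.Injective fun g : G => g ^ 2 :=
    (powCoprime (Nat.coprime_two_right.2 hG)).injective
  have hset : (fun g : G => g ^ 2) '' D = D := by
    apply groupRingElt_injective
    rw [← mapDomain_groupRingElt_of_injective hinj]
    exact hsq
  induction n with
  | zero => simpa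
  | succ n ih =>
    rw [pow_succ, pow_mul, ← hset]
    exact ⟨_, ih, rfl⟩

/-- A normalized difference set with the parameters of `PG(3, q)`, `q = 2^s`, meets the subgroup of
order `q ^ 2 + 1` in the identity only. -/
theorem inter_ker_pow_sq_add_one (hq : q = 2 ^ s)
    (hD : IsDifferenceSet D (q ^ 3 + q ^ 2 + q + 1) (q ^ 2 + q + 1) (q + 1))
    (hsq : groupRingSq G (groupRingElt D) = groupRingElt D) (hG : Odd (Nat.card G))
    (hcop : (q + 1).Coprime (q ^ 2 + 1)) :
    D ∩ {g | g ^ (q ^ 2 + 1) = 1} = {1} := by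
  set B := (powMonoidHom (q ^ 2 + 1) : G →* G).ker
  have hGB : Nat.card G = (q ^ 2 + 1) * (q + 1) := by rw [hD.1]; ring
  have hH : Nat.card (G ⧸ B) = q + 1 := card_quotient_powMonoidHom_ker hcop.symm hGB
  have hodd : Odd (Nat.card (G ⧸ B)) :=
    Odd.of_dvd_nat hG (hH ▸ hGB ▸ dvd_mul_left _ _)
  have h := mapDomain_eq_of_card_eq_add_one hq hD hsq (QuotientGroup.mk' B)
    (QuotientGroup.mk'_surjective B) hH hodd
  -- The coefficient at 1 reads |D ∩ B| + q = q + 1. The single common element is then its own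
  -- square.
  have h1 := congrArg (fun z => z.coeff 1) h
  rw [← nsmul_eq_mul, coeff_smul_apply, coeff_groupRingElt_univ, coeff_add, Finsupp.add_apply,
    coeff_mapDomain_groupRingElt, coeff_natCast, Finsupp.single_eq_same] at h1
  have hker : QuotientGroup.mk' B ⁻¹' {1} = {g : G | g ^ (q ^ 2 + 1) = 1} := by
    ext g
    rw [Set.mem_preimage, Set.mem_singleton_iff, ← MonoidHom.mem_ker, QuotientGroup.ker_mk']
    rfl
  rw [hker] at h1
  have hone : (D ∩ {g : G | g ^ (q ^ 2 + 1) = 1}).ncard = 1 := by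
    simp only [nsmul_eq_mul, mul_one] at h1
    push_cast at h1
    have : ((D ∩ {g : G | g ^ (q ^ 2 + 1) = 1}).ncard : ℤ) = 1 := by linarith
    exact_mod_cast this
  obtain ⟨b, hb⟩ := Set.ncard_eq_one.1 hone
  have hbm : b ∈ D ∩ {g : G | g ^ (q ^ 2 + 1) = 1} := hb ▸ rfl
  have hb2 : b ^ 2 ∈ D ∩ {g : G | g ^ (q ^ 2 + 1) = 1} := by
    refine ⟨by simpa using mem_pow_two_pow_of_groupRingSq hsq hG 1 hbm.1, ?_⟩
    have := hbm.2
    simp only [Set.mem_ofPred_eq] at this ⊢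
    rw [← pow_mul, mul_comm, pow_mul, this, one_pow]
  rw [hb, Set.mem_singleton_iff, sq, mul_eq_left] at hb2
  rw [hb, hb2]

/-- Let `A` be the subgroup of order `q + 1`. A normalized difference set with the parameters of
`PG(3, q)`, `q = 2^s`, contains `A` and meets every other coset of `A` in exactly one element. -/
theorem ker_pow_add_one_subset_and_existsUnique (hq : q = 2 ^ s)
    (hD : IsDifferenceSet D (q ^ 3 + q ^ 2 + q + 1) (q ^ 2 + q + 1) (q + 1))
    (hsq : groupRingSq G (groupRingElt D) = groupRingElt D) (hG : Odd (Nat.card G))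
    (hcop : (q + 1).Coprime (q ^ 2 + 1)) :
    (∀ g : G, g ^ (q + 1) = 1 → g ∈ D) ∧
      ∀ g : G, g ^ (q + 1) ≠ 1 → ∃! d, d ∈ D ∧ (d / g) ^ (q + 1) = 1 := by
  classical
  set A := (powMonoidHom (q + 1) : G →* G).ker with hA
  have hGA : Nat.card G = (q + 1) * (q ^ 2 + 1) := by rw [hD.1]; ring
  have hH : Nat.card (G ⧸ A) = q ^ 2 + 1 := card_quotient_powMonoidHom_ker hcop hGA
  have hodd : Odd (Nat.card (G ⧸ A)) :=
    Odd.of_dvd_nat hG (hH ▸ hGA ▸ dvd_mul_left _ _)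
  have h := mapDomain_eq_of_card_eq_sq_add_one hq hD hsq (QuotientGroup.mk' A)
    (QuotientGroup.mk'_surjective A) hH hodd
  have hcoset : ∀ g : G, QuotientGroup.mk' A ⁻¹' {QuotientGroup.mk' A g} =
      {d : G | (d / g) ^ (q + 1) = 1} := by
    intro g
    ext d
    rw [Set.mem_preimage, Set.mem_singleton_iff, ← div_eq_one, ← map_div, ← MonoidHom.mem_ker,
      QuotientGroup.ker_mk']
    rfl
  have hcount : ∀ g : G, (D ∩ {d : G | (d / g) ^ (q + 1) = 1}).ncard =
      1 + if g ^ (q + 1) = 1 then q else 0 := by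
    intro g
    have h1 := congrArg (fun z => z.coeff (QuotientGroup.mk' A g)) h
    rw [coeff_add, Finsupp.add_apply, coeff_groupRingElt_univ, coeff_mapDomain_groupRingElt,
      coeff_natCast, hcoset, Finsupp.single_apply] at h1
    have hiff : (1 : G ⧸ A) = QuotientGroup.mk' A g ↔ g ^ (q + 1) = 1 := by
      rw [eq_comm, ← MonoidHom.mem_ker, QuotientGroup.ker_mk']
      rfl
    simp only [hiff] at h1
    split_ifs at h1 ⊢ <;> exact_mod_cast h1
  constructor
  · have hsub : D ∩ (A : Set G) = A := by
      refine Set.eq_of_subset_of_ncard_le Set.inter_subset_right ?_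
      have := hcount 1
      simp only [div_one, one_pow, if_true] at this
      change _ ≤ (D ∩ {d : G | d ^ (q + 1) = 1}).ncard
      rw [this, add_comm]
      exact (card_powMonoidHom_ker hcop hGA).le
    intro g hg
    have : g ∈ (A : Set G) := hg
    rw [← hsub] at this
    exact this.1
  · intro g hg
    have := hcount g
    rw [if_neg hg, add_zero] at this
    obtain ⟨d, hd⟩ := Set.ncard_eq_one.1 this
    exact ⟨d, (Set.ext_iff.1 hd d).2 rfl, fun y hy => (Set.ext_iff.1 hd y).1 hy⟩

end Structure

/-! ### The elements of orders 3 and 5 and the subgroup they generate. -/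

section Assembly

/-- A set `D` closed under squaring that meets the subgroup of order `q ^ 2 + 1` trivially and
each nontrivial coset of the subgroup of order `q + 1` once contains some `h * k` with `h` of order
`3` and `k` of order `5`. -/
theorem exists_orderOf_three_five_mul_mem {G : Type*} [CommGroup G] [Finite G] {q : ℕ} {D : Set G}
    (hcard : Nat.card G = (q + 1) * (q ^ 2 + 1)) (h5 : 5 ∣ q ^ 2 + 1)
    (hcop : (q + 1).Coprime (q ^ 2 + 1)) (hsq : ∀ n : ℕ, ∀ g ∈ D, g ^ 2 ^ n ∈ D)
    (hB : D ∩ {g | g ^ (q ^ 2 + 1) = 1} = {1})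
    (hA' : ∀ g : G, g ^ (q + 1) ≠ 1 → ∃! d, d ∈ D ∧ (d / g) ^ (q + 1) = 1) :
    ∃ h k : G, orderOf h = 3 ∧ orderOf k = 5 ∧ h ^ (q + 1) = 1 ∧ k ^ (q ^ 2 + 1) = 1 ∧
      k ^ (q + 1) ≠ 1 ∧ h * k ∈ D := by
  have := Fact.mk Nat.prime_five
  have := Fact.mk Nat.prime_three
  obtain ⟨k, hk⟩ := exists_prime_orderOf_dvd_card' (G := G) 5 (hcard ▸ dvd_mul_of_dvd_right h5 _)
  have hkB : k ^ (q ^ 2 + 1) = 1 := orderOf_dvd_iff_pow_eq_one.1 (hk ▸ h5)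
  have h5q : Nat.Coprime 5 (q + 1) := (hcop.coprime_dvd_right h5).symm
  have hkA : k ^ (q + 1) ≠ 1 := fun h => by
    have h1 := orderOf_dvd_of_pow_eq_one h
    rw [hk] at h1
    exact absurd (Nat.eq_one_of_dvd_coprimes h5q dvd_rfl h1) (by norm_num)
  obtain ⟨d, ⟨hdD, hdk⟩, hduniq⟩ := hA' k hkA
  set h := d / k with hh
  have hd : d = h * k := by rw [hh, div_mul_cancel]
  have hk5 : k ^ 5 = 1 := hk ▸ pow_orderOf_eq_one k
  -- 16 = 2 ^ 4 is 1 modulo 5, so d ^ 16 lies in D and in the same coset of A as k; uniqueness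
  -- applies.
  have hd16 : d ^ 16 = d := by
    refine hduniq _ ⟨hsq 4 d hdD, ?_⟩
    have : d ^ 16 / k = h ^ 16 := by
      rw [hd, mul_pow, show k ^ 16 = (k ^ 5) ^ 3 * k by rw [← pow_mul, ← pow_succ], hk5, one_pow,
        one_mul, mul_div_cancel_right]
    rw [this, ← pow_mul, mul_comm, pow_mul, hdk, one_pow]
  have hh15 : h ^ 15 = 1 := by
    have hd15 : d ^ 15 = 1 := by rwa [pow_succ, mul_eq_right] at hd16
    rw [hh, div_pow, hd15, show 15 = 5 * 3 from rfl, pow_mul, hk5, one_pow, div_one]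
  have hord : orderOf h ∣ 3 := by
    have hc : (orderOf h).Coprime 5 :=
      (h5q.coprime_dvd_right (orderOf_dvd_of_pow_eq_one hdk)).symm
    exact hc.dvd_of_dvd_mul_right (orderOf_dvd_of_pow_eq_one hh15)
  have hne : h ≠ 1 := fun h1 => by
    have : k ∈ D ∩ {g | g ^ (q ^ 2 + 1) = 1} := ⟨by rwa [hd, h1, one_mul] at hdD, hkB⟩
    rw [hB, Set.mem_singleton_iff] at this
    rw [this, orderOf_one] at hk
    norm_num at hk
  exact ⟨h, k, orderOf_eq_prime (orderOf_dvd_iff_pow_eq_one.1 hord) hne, hk, hdk, hkB, hkA, hd ▸ hdD⟩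

/-- For g = hk, exponents divisible by 5 give elements of A and those divisible by 3 give elements
of B. Each nonzero class modulo 5 lies in one nontrivial coset of A, whose only point of D is one of
g, g ^ 2, g ^ 4, g ^ 8. -/
theorem pow_mem_iff_of_orderOf_eq_fifteen {G : Type*} [CommGroup G] {q : ℕ} {D : Set G} {h k : G}
    (hsq : ∀ n : ℕ, ∀ g ∈ D, g ^ 2 ^ n ∈ D)
    (hB : D ∩ {g | g ^ (q ^ 2 + 1) = 1} = {1}) (hA : ∀ g : G, g ^ (q + 1) = 1 → g ∈ D)
    (hA' : ∀ g : G, g ^ (q + 1) ≠ 1 → ∃! d, d ∈ D ∧ (d / g) ^ (q + 1) = 1)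
    (hh : orderOf h = 3) (hk : orderOf k = 5) (hhA : h ^ (q + 1) = 1)
    (hkB : k ^ (q ^ 2 + 1) = 1) (hkA : k ^ (q + 1) ≠ 1) (hhk : h * k ∈ D) (i : ℕ) (hi : i < 15) :
    (h * k) ^ i ∈ D ↔ i ∈ ({0, 1, 2, 4, 5, 8, 10} : Set ℕ) := by
  have hh3 : h ^ 3 = 1 := hh ▸ pow_orderOf_eq_one h
  have hk5 : k ^ 5 = 1 := hk ▸ pow_orderOf_eq_one k
  set g := h * k with hg
  have hord : orderOf g = 15 := by
    rw [hg, (Commute.all h k).orderOf_mul_eq_mul_orderOf_of_coprime (by rw [hh, hk]; norm_num),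
      hh, hk]
  have hred : ∀ n, g ^ (n + 15) = g ^ n := fun n => by
    rw [pow_add, ← hord, pow_orderOf_eq_one, mul_one]
  have hg10 : g ^ 10 = h := by
    rw [hg, mul_pow, show h ^ 10 = (h ^ 3) ^ 3 * h by rw [← pow_mul, ← pow_succ],
      show k ^ 10 = (k ^ 5) ^ 2 by rw [← pow_mul], hh3, hk5, one_pow, one_pow, one_mul, mul_one]
  have hg6 : g ^ 6 = k := by
    rw [hg, mul_pow, show h ^ 6 = (h ^ 3) ^ 2 by rw [← pow_mul],
      show k ^ 6 = k ^ 5 * k by rw [← pow_succ], hh3, hk5, one_pow, one_mul, one_mul]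
  have hmulA : ∀ n, (g ^ (5 * n)) ^ (q + 1) = 1 := fun n => by
    have : g ^ 5 = h ^ 2 := by rw [← hg10, ← pow_mul, ← hred 5]
    rw [pow_mul, this, ← pow_mul, ← pow_mul, ← mul_assoc, mul_comm, pow_mul, hhA, one_pow]
  have hmulB : ∀ n, 3 * n < 15 → 0 < n → g ^ (3 * n) ∉ D := fun n hn hn0 hD => by
    have h6 : (g ^ 3) ^ (q ^ 2 + 1) = 1 := by
      have : g ^ 3 = k ^ 3 := by rw [← hg6, ← pow_mul, ← hred 3]
      rw [this, ← pow_mul, mul_comm, pow_mul, hkB, one_pow]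
    have : g ^ (3 * n) ∈ D ∩ {g | g ^ (q ^ 2 + 1) = 1} := by
      refine ⟨hD, ?_⟩
      rw [Set.mem_ofPred_eq, pow_mul, ← pow_mul, mul_comm, pow_mul, h6, one_pow]
    rw [hB, Set.mem_singleton_iff] at this
    have := Nat.le_of_dvd (by omega) (orderOf_dvd_of_pow_eq_one this)
    omega
  have hpow : ∀ n, g ^ 2 ^ n ∈ D := fun n => hsq n g hhk
  -- The relation a b ≡ 6 modulo 15 makes k = g ^ 6 a power of g ^ a, and k is not in A.
  have hnotA : ∀ a b c : ℕ, a * b = 6 + 15 * c → (g ^ a) ^ (q + 1) ≠ 1 := fun a b c hab h1 => by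
    apply hkA
    have : k = (g ^ a) ^ b := by
      rw [← pow_mul, hab, pow_add, pow_mul, ← hord, pow_orderOf_eq_one, one_pow, mul_one, hg6]
    rw [this, ← pow_mul, mul_comm, pow_mul, h1, one_pow]
  have huniq : ∀ a n : ℕ, a + 5 * n < 15 → 0 < n → (g ^ a) ^ (q + 1) ≠ 1 → g ^ a ∈ D →
      g ^ (a + 5 * n) ∉ D := fun a n hn hn0 ha haD hD => by
    have h1 := (hA' (g ^ a) ha).unique ⟨haD, by rw [div_self', one_pow]⟩
      ⟨hD, by rw [pow_add g, mul_div_cancel_left, hmulA]⟩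
    have := pow_injOn_Iio_orderOf (x := g) (by rw [hord]; simp; omega) (by rw [hord]; simp; omega) h1
    omega
  have h0 : g ^ 0 ∈ D := hA _ (by rw [pow_zero, one_pow])
  have h1 : g ^ 1 ∈ D := hpow 0
  have h2 : g ^ 2 ∈ D := hpow 1
  have h4 : g ^ 4 ∈ D := hpow 2
  have h5 : g ^ 5 ∈ D := hA _ (hmulA 1)
  have h8 : g ^ 8 ∈ D := hpow 3
  have h10 : g ^ 10 ∈ D := hA _ (hmulA 2)
  have h3 : g ^ 3 ∉ D := hmulB 1 (by norm_num) (by norm_num)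
  have h6 : g ^ 6 ∉ D := hmulB 2 (by norm_num) (by norm_num)
  have h9 : g ^ 9 ∉ D := hmulB 3 (by norm_num) (by norm_num)
  have h12 : g ^ 12 ∉ D := hmulB 4 (by norm_num) (by norm_num)
  have h7 : g ^ 7 ∉ D := huniq 2 1 (by norm_num) (by norm_num) (hnotA 2 3 0 rfl) h2
  have h11 : g ^ 11 ∉ D := huniq 1 2 (by norm_num) (by norm_num) (hnotA 1 6 0 rfl) h1
  have h13 : g ^ 13 ∉ D := huniq 8 1 (by norm_num) (by norm_num) (hnotA 8 12 6 rfl) h8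
  have h14 : g ^ 14 ∉ D := huniq 4 2 (by norm_num) (by norm_num) (hnotA 4 9 2 rfl) h4
  interval_cases i <;> first
    | exact iff_of_true ‹_› (by simp)
    | exact iff_of_false ‹_› (by simp)

/-- The parameters of `PG(3, q)` as polynomials in `q = 2^s`. -/
theorem projective_parameters {s : ℕ} (hs : s ≠ 0) :
    (2 ^ (4 * s) - 1) / (2 ^ s - 1) = (2 ^ s) ^ 3 + (2 ^ s) ^ 2 + 2 ^ s + 1 ∧
      (2 ^ (3 * s) - 1) / (2 ^ s - 1) = (2 ^ s) ^ 2 + 2 ^ s + 1 ∧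
      (2 ^ (2 * s) - 1) / (2 ^ s - 1) = 2 ^ s + 1 := by
  have hq : 1 < 2 ^ s := Nat.one_lt_two_pow hs
  rw [mul_comm 4, mul_comm 3, mul_comm 2, pow_mul, pow_mul, pow_mul]
  generalize 2 ^ s = q at hq
  obtain ⟨r, rfl⟩ := Nat.exists_eq_add_of_lt hq
  have hr : 0 < 1 + r + 1 - 1 := by omega
  refine ⟨Nat.div_eq_of_eq_mul_left hr ?_, Nat.div_eq_of_eq_mul_left hr ?_,
    Nat.div_eq_of_eq_mul_left hr ?_⟩ <;>
  · rw [show 1 + r + 1 - 1 = r + 1 by omega]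
    refine Nat.sub_eq_of_eq_add ?_
    ring

theorem theorem6p1 {G : Type*} [CommGroup G] [Finite G] (s : ℕ) (hs : Odd s) (D : Set G)
    (hD : IsDifferenceSet D ((2 ^ (4 * s) - 1) / (2 ^ s - 1)) ((2 ^ (3 * s) - 1) / (2 ^ s - 1))
      ((2 ^ (2 * s) - 1) / (2 ^ s - 1)))
    (hnorm : IsNormalized D) :
    ∃ M : Subgroup G, Nat.card M = 15 ∧
      IsDifferenceSet ((M.subtype : M → G) ⁻¹' D) 15 7 3 ∧
      ∃ h ∈ M, ∃ k ∈ M, orderOf h = 3 ∧ orderOf k = 5 ∧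
        D ∩ (M : Set G) =
          {1, h, h ^ 2, h * k, h ^ 2 * k ^ 2, h * k ^ 4, h ^ 2 * k ^ 3} := by
  obtain ⟨e1, e2, e3⟩ := projective_parameters hs.pos.ne'
  rw [e1, e2, e3] at hD
  -- 4 + 1 divides 4 ^ s + 1 because s is odd.
  have h5 : 5 ∣ (2 ^ s) ^ 2 + 1 := by
    have := hs.nat_add_dvd_pow_add_pow 4 1
    rwa [one_pow, show 4 = 2 ^ 2 from rfl, ← pow_mul, mul_comm 2 s, pow_mul] at this
  have hev : Even (2 ^ s) := (Nat.even_pow.2 ⟨even_two, hs.pos.ne'⟩)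
  have hq1 : 1 ≤ 2 ^ s := Nat.one_le_two_pow
  obtain ⟨q, hq⟩ : ∃ q, q = 2 ^ s := ⟨_, rfl⟩
  rw [← hq] at hD h5 hev hq1
  -- q ^ 2 + 1 = 2 + (q + 1)(q - 1), and q + 1 is odd.
  have hcop : (q + 1).Coprime (q ^ 2 + 1) := by
    obtain ⟨r, rfl⟩ := Nat.exists_eq_add_of_le hq1
    have : (1 + r) ^ 2 + 1 = 2 + (1 + r + 1) * r := by ring
    rw [this, Nat.coprime_add_mul_left_right, Nat.coprime_two_right]
    exact hev.add_one
  have hcard : Nat.card G = (q + 1) * (q ^ 2 + 1) := by rw [hD.1]; ring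
  have hG : Odd (Nat.card G) :=
    hcard ▸ hev.add_one.mul (hev.pow_of_ne_zero two_ne_zero).add_one
  have hsq := hnorm.groupRingSq_groupRingElt hq hD hG
  have hpow : ∀ n : ℕ, ∀ g ∈ D, g ^ 2 ^ n ∈ D := fun n g hg =>
    mem_pow_two_pow_of_groupRingSq hsq hG n hg
  have hB := inter_ker_pow_sq_add_one hq hD hsq hG hcop
  obtain ⟨hA, hA'⟩ := ker_pow_add_one_subset_and_existsUnique hq hD hsq hG hcop
  obtain ⟨h, k, hh, hk, hhA, hkB, hkA, hhk⟩ :=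
    exists_orderOf_three_five_mul_mem hcard h5 hcop hpow hB hA'
  have hiff := pow_mem_iff_of_orderOf_eq_fifteen hpow hB hA hA' hh hk hhA hkB hkA hhk
  have hh3 : h ^ 3 = 1 := hh ▸ pow_orderOf_eq_one h
  have hk5 : k ^ 5 = 1 := hk ▸ pow_orderOf_eq_one k
  have hord : orderOf (h * k) = 15 := by
    rw [(Commute.all h k).orderOf_mul_eq_mul_orderOf_of_coprime (by rw [hh, hk]; norm_num), hh, hk]
  classical
  have hinter : D ∩ (Subgroup.zpowers (h * k) : Set G) =
      ((h * k) ^ ·) '' ({0, 1, 2, 4, 5, 8, 10} : Set ℕ) := by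
    ext x
    constructor
    · rintro ⟨hxD, hx⟩
      rw [SetLike.mem_coe, (isOfFinOrder_of_finite _).mem_zpowers_iff_mem_range_orderOf, hord] at hx
      obtain ⟨i, hi, rfl⟩ := Finset.mem_image.1 hx
      exact ⟨i, (hiff i (Finset.mem_range.1 hi)).1 hxD, rfl⟩
    · rintro ⟨i, hi, rfl⟩
      refine ⟨(hiff i ?_).2 hi, Subgroup.npow_mem_zpowers _ _⟩
      simp only [Set.mem_insert_iff, Set.mem_singleton_iff] at hi
      omega
  have hMcard : Nat.card (Subgroup.zpowers (h * k)) = 15 := by rw [Nat.card_zpowers, hord]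
  have hhpow : h = (h * k) ^ 10 := by
    rw [mul_pow, show h ^ 10 = (h ^ 3) ^ 3 * h by rw [← pow_mul, ← pow_succ],
      show k ^ 10 = (k ^ 5) ^ 2 by rw [← pow_mul], hh3, hk5, one_pow, one_pow, one_mul, mul_one]
  have hkpow : k = (h * k) ^ 6 := by
    rw [mul_pow, show h ^ 6 = (h ^ 3) ^ 2 by rw [← pow_mul],
      show k ^ 6 = k ^ 5 * k by rw [← pow_succ], hh3, hk5, one_pow, one_mul, one_mul]
  refine ⟨Subgroup.zpowers (h * k), hMcard, ?_, h,
    (Subgroup.mem_zpowers_iff.2 ⟨10, by exact_mod_cast hhpow.symm⟩), k,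
    (Subgroup.mem_zpowers_iff.2 ⟨6, by exact_mod_cast hkpow.symm⟩), hh, hk, ?_⟩
  · set γ : Subgroup.zpowers (h * k) := ⟨h * k, Subgroup.mem_zpowers _⟩
    have hγ : orderOf γ = 15 := by rw [← hord, ← Subgroup.orderOf_coe]
    suffices heq : (Subgroup.zpowers (h * k)).subtype ⁻¹' D =
        (γ ^ ·) '' ({0, 1, 2, 4, 5, 8, 10} : Set ℕ) by
      rw [heq]
      exact isDifferenceSet_pow_image hMcard hγ
    ext x
    have : x ∈ ((Subgroup.zpowers (h * k)).subtype ⁻¹' D) ↔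
        (x : G) ∈ D ∩ (Subgroup.zpowers (h * k) : Set G) := ⟨fun hx => ⟨hx, x.2⟩, fun hx => hx.1⟩
    rw [this, hinter]
    simp only [Set.mem_image, Subtype.ext_iff]
    rfl
  · rw [hinter]
    have p5 : (h * k) ^ 5 = h ^ 2 := by
      rw [mul_pow, show h ^ 5 = h ^ 3 * h ^ 2 by rw [← pow_add], hh3, hk5, one_mul, mul_one]
    have p4 : (h * k) ^ 4 = h * k ^ 4 := by
      rw [mul_pow, show h ^ 4 = h ^ 3 * h by rw [← pow_succ], hh3, one_mul]
    have p8 : (h * k) ^ 8 = h ^ 2 * k ^ 3 := by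
      rw [mul_pow, show h ^ 8 = (h ^ 3) ^ 2 * h ^ 2 by rw [← pow_mul, ← pow_add],
        show k ^ 8 = k ^ 5 * k ^ 3 by rw [← pow_add], hh3, hk5, one_pow, one_mul, one_mul]
    simp only [Set.image_insert_eq, Set.image_singleton, pow_zero, pow_one, ← hhpow, p5, p4, p8]
    rw [mul_pow]
    ext x
    simp only [Set.mem_insert_iff, Set.mem_singleton_iff]
    tauto

end Assembly
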